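/- All graphs are finite and simple. A graph is \emph{chordal} if it has no induced cycle of length greater than $3$; $G$ is \emph{co-chordal} if its complement $G^c$ is chordal. A \emph{clique tree} of a chordal graph $H$ is a tree whose nodes are the maximal cliques of $H$ and in which every clique on the path between two nodes $K,K'$ contains $K\cap K'$. For an edge $e=KK'$ of a clique tree put $\operatorname{mid}(e)=K\cap K'$. A \emph{biclique} $\{L,R\}$ of $G$ consists of two nonempty disjoint vertex sets with every vertex of $L$ adjacent in $G$ to every vertex of $R$; a \emph{biclique cover} of $G$ is a set of bicliques of $G$ such that every edge of $G$ joins the two sides of at least one of them, and $\operatorname{bc}(G)$ is the minimum size of a biclique cover. An \emph{edge-ranking} of a tree $T$ with $r$ ranks is a map $\varphi:E(T)\to\{1,\dots,r\}$ such that for any two distinct edges $e_1,e_2$ with $\varphi(e_1)=\varphi(e_2)$ some edge $e_3$ on the path between them has $\varphi(e_3)>\varphi(e_1)$; $\chi_r'(T)$ is the minimum number of ranks of an edge-ranking of $T$, and an edge-ranking is \emph{optimal} if it uses $\chi'_r(T)$ ranks. Given $G$ and a clique tree $T$ of $G^c$, consider the following algorithm. Choose an optimal edge-ranking $\varphi$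 of $T$, put $r=\chi_r'(T)$, and number the nodes of $T$ by $\sigma$ in the order of a breadth-first search started at a leaf (the only node, if $T$ has just one node). Start with empty lists $B_1,\dots,B_r$ and call $\mathrm{FindBiclique}(T)$, where $\mathrm{FindBiclique}(T')$ for a subtree $T'$ does nothing if $T'$ has at most one node, and otherwise picks an edge $e$ of $T'$ with $\varphi(e)$ maximum, lets $T_1,T_2$ be the two components of $T'\setminus e$, adds to $B_{r+1-\varphi(e)}$ the biclique $\{L,R\}$ with $$L=\bigcup_{K\in V(T_1)}K\setminus\operatorname{mid}(e),\qquad R=\bigcup_{K\in V(T_2)}K\setminus\operatorname{mid}(e)$$ and with sorting key $\min\{\sigma(K):K\in V(T')\}$, and then calls $\mathrm{FindBiclique}(T_1)$ and $\mathrm{FindBiclique}(T_2)$. Then, for each level $i=1,\dots,r$, start with $C_i=\emptyset$ and go through the bicliques $\{L,R\}$ of $B_i$ in ascending order of their keys: replace each member $\{L',R'\}$ of $C_i$ by $\{L\cup L',R\cup R'\}$ if this is a biclique of $G$, else by $\{R\cup L',L\cup R'\}$ if this is a biclique of $G$; if no member of $C_i$ could be so replaced, add $\{L,R\}$ to $C_i$.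 Return $C_1\cup\dots\cup C_r$. \textbf{Theorem.} Let $G$ be a co-chordal graph such that each vertex of $G$ is in at most two maximal independent sets of $G$, and let $T$ be any clique tree of $G^c$. Then the algorithm, with every way of making its choices, returns a biclique cover of $G$ of size at most $\chi_r'(T)$. Consequently $\operatorname{bc}(G)\le\chi_r'(T)$. -/

import Mathlib

namespace BicliqueBound

universe u

/-! ### Chordal graphs, maximal cliques, clique trees -/

/-- A graph is chordal if it has no induced cycle of length greater than 3. -/
def IsChordal {V : Type u} (H : SimpleGraph V) : Prop :=
  ∀ n : ℕ, 3 < n → IsEmpty (SimpleGraph.cycleGraph n ↪g H)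

/-- A graph is co-chordal if its complement is chordal. -/
def IsCoChordal {V : Type u} (G : SimpleGraph V) : Prop :=
  IsChordal Gᶜ

/-- Every vertex of `G` lies in at most two maximal independent sets of `G`. -/
def InAtMostTwoMaxIndepSets {V : Type u} [Fintype V] (G : SimpleGraph V) : Prop :=
  ∀ v : V, {I : Finset V | Maximal (fun s : Finset V => G.IsIndepSet (s : Set V)) I ∧ v ∈ I}.ncard ≤ 2

/-- The type of all maximal cliques of `H`. -/
def MaxClique {V : Type u} (H : SimpleGraph V) : Type u :=
  {K : Finset V // Maximal (fun s : Finset V => H.IsClique (s : Set V)) K}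

/-- The vertex set of a maximal clique. -/
def MaxClique.verts {V : Type u} {H : SimpleGraph V} (K : MaxClique H) : Finset V := K.1

instance MaxClique.instFinite {V : Type u} [Fintype V] (H : SimpleGraph V) : Finite (MaxClique H) :=
  inferInstanceAs (Finite {K : Finset V // Maximal (fun s : Finset V => H.IsClique (s : Set V)) K})

noncomputable instance MaxClique.instFintype {V : Type u} [Fintype V] (H : SimpleGraph V) :
    Fintype (MaxClique H) := Fintype.ofFinite _

/-- `T` is a clique tree of `H`: a tree whose nodes are the maximal cliques of `H`, such that every
clique on the path between `K₁` and `K₂` contains `K₁ ∩ K₂`. -/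
structure IsCliqueTree {V : Type u} [DecidableEq V] (H : SimpleGraph V)
    (T : SimpleGraph (MaxClique H)) : Prop where
  isTree : T.IsTree
  inter_subset : ∀ (K₁ K₂ : MaxClique H) (p : T.Walk K₁ K₂), p.IsPath →
    ∀ K ∈ p.support, K₁.verts ∩ K₂.verts ⊆ K.verts

/-! ### Edge-rankings of trees -/

/-- `φ` is an edge-ranking of the tree `T` with ranks `1, …, r`: whenever two distinct edges have the
same rank, the path joining them has an edge of larger rank. (Only the values of `φ` on edges of `T`
matter. In a tree, a path through both edges consists of the path joining them, possibly prolonged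
beyond them; the condition for all such paths amounts to the condition for the shortest one.) -/
def IsEdgeRanking {N : Type u} (T : SimpleGraph N) (r : ℕ) (φ : Sym2 N → ℕ) : Prop :=
  (∀ e ∈ T.edgeSet, 1 ≤ φ e ∧ φ e ≤ r) ∧
  ∀ (a b : N) (p : T.Walk a b), p.IsPath →
    ∀ e₁ ∈ p.edges, ∀ e₂ ∈ p.edges, e₁ ≠ e₂ → φ e₁ = φ e₂ → ∃ e₃ ∈ p.edges, φ e₁ < φ e₃

/-- The optimal edge-ranking number `χ'_r(T)`. -/
noncomputable def edgeRankingNumber {N : Type u} (T : SimpleGraph N) : ℕ :=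
  sInf {r : ℕ | ∃ φ : Sym2 N → ℕ, IsEdgeRanking T r φ}

/-- `φ` is an optimal edge-ranking of `T`. -/
def IsOptimalEdgeRanking {N : Type u} (T : SimpleGraph N) (φ : Sym2 N → ℕ) : Prop :=
  IsEdgeRanking T (edgeRankingNumber T) φ

/-! ### Bicliques and biclique covers -/

/-- The biclique with sides `L` and `R`, given as the pair `(L, R)`. -/
abbrev Biclique (V : Type u) : Type u := Finset V × Finset V

/-- `{L, R}` is a biclique subgraph of `G`. (The sides are then automatically disjoint.) -/
def IsBiclique {V : Type u} (G : SimpleGraph V) (b : Biclique V) : Prop :=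
  b.1.Nonempty ∧ b.2.Nonempty ∧ ∀ u ∈ b.1, ∀ v ∈ b.2, G.Adj u v

/-- `C` is a biclique cover of `G`. -/
def IsBicliqueCover {V : Type u} (G : SimpleGraph V) (C : Finset (Biclique V)) : Prop :=
  (∀ b ∈ C, IsBiclique G b) ∧
  ∀ u v : V, G.Adj u v → ∃ b ∈ C, (u ∈ b.1 ∧ v ∈ b.2) ∨ (v ∈ b.1 ∧ u ∈ b.2)

/-- The biclique cover number `bc(G)`. -/
noncomputable def bicliqueCoverNumber {V : Type u} (G : SimpleGraph V) : ℕ :=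
  sInf {n : ℕ | ∃ C : Finset (Biclique V), IsBicliqueCover G C ∧ C.card = n}

/-! ### Breadth-first search -/

/-- A leaf of a tree. (The only node of a one-node tree counts as a leaf.) -/
def IsLeaf {N : Type u} (T : SimpleGraph N) (v : N) : Prop :=
  (T.neighborSet v).Subsingleton

/-- Breadth-first search from `root`. In the state `(l, i)`, the list `l` holds the nodes discovered
so far in order of discovery and the first `i` of them are processed, so that the rest of `l` is the
queue. A step processes `l[i]` and appends its undiscovered neighbours, in arbitrary order. -/
inductive BFSState {N : Type u} (T : SimpleGraph N) (root : N) : List N → ℕ → Prop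
  | start : BFSState T root [root] 0
  | step (l new : List N) (i : ℕ) (hi : i < l.length) (hnodup : new.Nodup)
      (hnew : ∀ K, K ∈ new ↔ T.Adj l[i] K ∧ K ∉ l) (h : BFSState T root l i) :
      BFSState T root (l ++ new) (i + 1)

/-- `σ` numbers the nodes `1, 2, …` in the order in which some breadth-first search from `root`
visits them. -/
def IsBFSOrdering {N : Type u} (T : SimpleGraph N) (root : N) (σ : N → ℕ) : Prop :=
  ∃ l : List N, BFSState T root l l.length ∧ ∀ (i : ℕ) (hi : i < l.length), σ l[i] = i + 1

/-! ### The algorithm -/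

open Classical in
/-- A subtree of `T` is given by its node set `S`. Cutting it along its edge `K₁K₂` leaves two
subtrees; this is the node set of the one that contains `K₁`. -/
noncomputable def cutSide {N : Type u} (T : SimpleGraph N) (S : Finset N) (K₁ K₂ : N) : Finset N :=
  S.filter fun K => ∃ p : T.Walk K₁ K, (∀ A ∈ p.support, A ∈ S) ∧ s(K₁, K₂) ∉ p.edges

/-- One side of the biclique read off a cut: the vertices of the cliques in `S₁`, without the middle
set `K₁ ∩ K₂` of the cut edge. -/
def sideVerts {V : Type u} [DecidableEq V] {H : SimpleGraph V} (S₁ : Finset (MaxClique H))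
    (K₁ K₂ : MaxClique H) : Finset V :=
  S₁.biUnion MaxClique.verts \ (K₁.verts ∩ K₂.verts)

/-- The dictionary that stores, for each level, a list of bicliques with their sorting keys. -/
abbrev LevelDict (V : Type u) : Type u := ℕ → List (Biclique V × ℕ)

/-- The recursive subroutine: `FindBiclique T φ σ r S D D'` means that the call on the subtree with
node set `S` and dictionary `D` can end with the dictionary `D'`. On a subtree with more than one
node, it cuts along an edge `K₁K₂` of largest rank, adds the biclique of that cut to level
`r + 1 - φ(K₁K₂)` with the smallest BFS number in `S` as sorting key, and continues on both sides. -/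
inductive FindBiclique {V : Type u} [DecidableEq V] {H : SimpleGraph V}
    (T : SimpleGraph (MaxClique H)) (φ : Sym2 (MaxClique H) → ℕ) (σ : MaxClique H → ℕ) (r : ℕ) :
    Finset (MaxClique H) → LevelDict V → LevelDict V → Prop
  | done (S : Finset (MaxClique H)) (D : LevelDict V) (hS : S.card ≤ 1) :
      FindBiclique T φ σ r S D D
  | cut (S : Finset (MaxClique H)) (D D₀ D₁ D₂ : LevelDict V) (K₁ K₂ : MaxClique H) (level : ℕ)
      (hS : 1 < S.card) (h₁ : K₁ ∈ S) (h₂ : K₂ ∈ S) (hadj : T.Adj K₁ K₂)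
      (hmax : ∀ A ∈ S, ∀ B ∈ S, T.Adj A B → φ s(A, B) ≤ φ s(K₁, K₂))
      (hlevel : level = r + 1 - φ s(K₁, K₂))
      (hD₀ : D₀ = Function.update D level
        (D level ++ [((sideVerts (cutSide T S K₁ K₂) K₁ K₂, sideVerts (cutSide T S K₂ K₁) K₁ K₂),
          S.inf' ⟨K₁, h₁⟩ σ)]))
      (hrec₁ : FindBiclique T φ σ r (cutSide T S K₁ K₂) D₀ D₁)
      (hrec₂ : FindBiclique T φ σ r (cutSide T S K₂ K₁) D₁ D₂) :
      FindBiclique T φ σ r S D D₂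

/-- `{L, R}` can be merged into `{L', R'}`, in one of the two ways. -/
def Mergeable {V : Type u} [DecidableEq V] (G : SimpleGraph V) (b b' : Biclique V) : Prop :=
  IsBiclique G (b.1 ∪ b'.1, b.2 ∪ b'.2) ∨ IsBiclique G (b.2 ∪ b'.1, b.1 ∪ b'.2)

open Classical in
/-- The new value of `{L', R'}` after an attempt to merge `{L, R}` into it. -/
noncomputable def mergeInto {V : Type u} [DecidableEq V] (G : SimpleGraph V) (b b' : Biclique V) :
    Biclique V :=
  if IsBiclique G (b.1 ∪ b'.1, b.2 ∪ b'.2) then (b.1 ∪ b'.1, b.2 ∪ b'.2)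
  else if IsBiclique G (b.2 ∪ b'.1, b.1 ∪ b'.2) then (b.2 ∪ b'.1, b.1 ∪ b'.2)
  else b'

open Classical in
/-- Process one biclique `{L, R}`: merge it into each member of `C` where that is possible, and add it
to `C` as a new member if it could not be merged into any. -/
noncomputable def mergeStep {V : Type u} [DecidableEq V] (G : SimpleGraph V)
    (C : Finset (Biclique V)) (b : Biclique V) : Finset (Biclique V) :=
  if ∃ b' ∈ C, Mergeable G b b' then C.image (mergeInto G b) else insert b C

/-- The merging subroutine: sort by the keys, then process the bicliques one after the other. -/
noncomputable def mergeBiclique {V : Type u} [DecidableEq V] (G : SimpleGraph V)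
    (l : List (Biclique V × ℕ)) : Finset (Biclique V) :=
  ((l.mergeSort fun x y => decide (x.2 ≤ y.2)).map Prod.fst).foldl (mergeStep G) ∅

/-- The algorithm on `G` with clique tree `T` of the complement, optimal edge-ranking `φ` of `T` and
breadth-first ordering `σ` of `T` can return `C`: run `FindBiclique` on all of `T` with the empty
dictionary, merge the bicliques of each level `1, …, r` where `r` is the number of ranks of `φ`, and
collect the results. -/
def AlgorithmReturns {V : Type u} [Fintype V] [DecidableEq V] (G : SimpleGraph V)
    (T : SimpleGraph (MaxClique Gᶜ)) (φ : Sym2 (MaxClique Gᶜ) → ℕ) (σ : MaxClique Gᶜ → ℕ)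
    (C : Finset (Biclique V)) : Prop :=
  ∃ D : LevelDict V,
    FindBiclique T φ σ (edgeRankingNumber T) Finset.univ (fun _ => []) D ∧
    C = (Finset.Icc 1 (edgeRankingNumber T)).biUnion fun i => mergeBiclique G (D i)

end BicliqueBound

open BicliqueBound
/-!
Cutting a subtree of the clique tree along an edge `K₁K₂` gives a biclique: two non-adjacent
vertices lie in a common node, so if they come from different sides of the cut, then the path from
one of their own nodes to that common node runs through `K₁K₂` and puts one of them into `K₁ ∩ K₂`.
Conversely, adjacent vertices share no node, so some cut separates them.

The subtrees that are cut at one level are pairwise disjoint, because an edge of largest rank in a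
subtree is the only one of its rank there. Since every vertex lies in at most two nodes, two nodes
with a common vertex are adjacent. Hence, if a vertex `z` of a subtree `S` with first node `t` is
not adjacent to a vertex `x` of a subtree of the same level that starts earlier, then `z ∈ t` and
`x` is in the parent of `t`. Both nodes are independent in `G`, so all such `z` are on one side of
the biclique of `S`, and all such `x` are on one side of what has been merged before. Hence one of
the two orientations allows the merge, and every level ends with a single biclique.
-/

namespace BicliqueBound

open SimpleGraph

/-! ### Cuts of subtrees -/

section Cut

variable {N : Type*} {T : SimpleGraph N} {S : Finset N} {K₁ K₂ : N}

lemma preconnected_induce_iff_exists_walk {S : Set N} :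
    (T.induce S).Preconnected ↔
      ∀ A ∈ S, ∀ B ∈ S, ∃ p : T.Walk A B, ∀ C ∈ p.support, C ∈ S := by
  refine ⟨fun h A hA B hB => ?_, fun h ⟨A, hA⟩ ⟨B, hB⟩ => ?_⟩
  · obtain ⟨p⟩ := h ⟨A, hA⟩ ⟨B, hB⟩
    refine ⟨p.map (Embedding.induce S).toHom, fun C hC => ?_⟩
    obtain ⟨D, -, rfl⟩ := List.mem_map.1 (Walk.support_map _ p ▸ hC)
    exact D.2
  · obtain ⟨p, hp⟩ := h A hA B hB
    exact ⟨p.induce S hp⟩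

lemma exists_isPath_of_preconnected_induce (hS : (T.induce (S : Set N)).Preconnected) {A B : N}
    (hA : A ∈ S) (hB : B ∈ S) : ∃ p : T.Walk A B, p.IsPath ∧ ∀ C ∈ p.support, C ∈ S := by
  classical
  obtain ⟨p, hp⟩ := preconnected_induce_iff_exists_walk.1 hS A hA B hB
  exact ⟨p.bypass, p.bypass_isPath, fun C hC => hp C (p.support_bypass_subset_support hC)⟩

lemma preconnected_induce_univ [Fintype N] (hT : T.Connected) :
    (T.induce ((Finset.univ : Finset N) : Set N)).Preconnected :=
  preconnected_induce_iff_exists_walk.2 fun A _ B _ =>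
    (hT.preconnected A B).elim fun p => ⟨p, fun C _ => Finset.mem_univ C⟩

lemma mem_edges_of_isAcyclic (hT : T.IsAcyclic) {A B : N} (h : T.Adj A B) (p : T.Walk A B) :
    s(A, B) ∈ p.edges :=
  isBridge_iff_forall_walk_mem_edges.1 (isAcyclic_iff_forall_adj_isBridge.1 hT h) p

lemma mem_cutSide {K : N} :
    K ∈ cutSide T S K₁ K₂ ↔
      ∃ p : T.Walk K₁ K, (∀ A ∈ p.support, A ∈ S) ∧ s(K₁, K₂) ∉ p.edges := by
  classical
  simp only [cutSide, Finset.mem_filter, and_iff_right_iff_imp]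
  rintro ⟨p, hp, -⟩
  exact hp _ p.end_mem_support

variable (T S K₁ K₂) in
lemma cutSide_subset : cutSide T S K₁ K₂ ⊆ S := by
  classical exact Finset.filter_subset _ _

lemma left_mem_cutSide (h₁ : K₁ ∈ S) : K₁ ∈ cutSide T S K₁ K₂ :=
  mem_cutSide.2 ⟨.nil, by simpa using h₁, by simp⟩

variable (T S K₁ K₂) in
lemma preconnected_induce_cutSide : (T.induce (cutSide T S K₁ K₂ : Set N)).Preconnected := by
  classical
  have walk_from_left : ∀ A ∈ cutSide T S K₁ K₂,
      ∃ p : T.Walk K₁ A, ∀ C ∈ p.support, C ∈ cutSide T S K₁ K₂ := by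
    intro A hA
    obtain ⟨p, hp, he⟩ := mem_cutSide.1 hA
    exact ⟨p, fun C hC => mem_cutSide.2 ⟨p.takeUntil C hC,
      fun D hD => hp D (p.support_takeUntil_subset_support hC hD),
      fun h => he (p.edges_takeUntil_subset_edges hC h)⟩⟩
  refine preconnected_induce_iff_exists_walk.2 fun A hA B hB => ?_
  obtain ⟨p, hp⟩ := walk_from_left A hA
  obtain ⟨q, hq⟩ := walk_from_left B hB
  refine ⟨p.reverse.append q, fun C hC => ?_⟩
  rw [Walk.mem_support_append_iff, Walk.support_reverse, List.mem_reverse] at hC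
  exact hC.elim (hp C) (hq C)

lemma mem_cutSide_or_mem_cutSide (hS : (T.induce (S : Set N)).Preconnected) (h₁ : K₁ ∈ S) {K : N}
    (hK : K ∈ S) : K ∈ cutSide T S K₁ K₂ ∨ K ∈ cutSide T S K₂ K₁ := by
  obtain ⟨p, hp, hpS⟩ := exists_isPath_of_preconnected_induce hS h₁ hK
  by_cases he : s(K₁, K₂) ∈ p.edges
  · right
    cases p with
    | nil => simp at he
    | @cons _ v _ h q =>
      rw [Walk.cons_isPath_iff] at hp
      have hq : s(K₁, K₂) ∉ q.edges := fun h' => hp.2 (q.fst_mem_support_of_mem_edges h')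
      obtain rfl : K₂ = v := by
        rwa [Walk.edges_cons, List.mem_cons, or_iff_left hq, Sym2.congr_right] at he
      exact mem_cutSide.2 ⟨q, fun A hA => hpS A (List.mem_cons_of_mem _ hA), Sym2.eq_swap ▸ hq⟩
  · exact Or.inl (mem_cutSide.2 ⟨p, hpS, he⟩)

lemma mem_edges_of_mem_cutSide (hT : T.IsAcyclic) (h : T.Adj K₁ K₂) {A B : N}
    (hA : A ∈ cutSide T S K₁ K₂) (hB : B ∈ cutSide T S K₂ K₁) (w : T.Walk A B) :
    s(K₁, K₂) ∈ w.edges := by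
  obtain ⟨p, -, hp⟩ := mem_cutSide.1 hA
  obtain ⟨q, -, hq⟩ := mem_cutSide.1 hB
  have hmem := mem_edges_of_isAcyclic hT h ((p.append w).append q.reverse)
  rw [Walk.edges_append, List.mem_append, Walk.edges_append, List.mem_append, Walk.edges_reverse,
    List.mem_reverse] at hmem
  rw [Sym2.eq_swap] at hq
  exact (hmem.resolve_right hq).resolve_left hp

lemma disjoint_cutSide (hT : T.IsAcyclic) (h : T.Adj K₁ K₂) :
    Disjoint (cutSide T S K₁ K₂) (cutSide T S K₂ K₁) :=
  Finset.disjoint_left.2 fun _ hK hK' =>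
    List.not_mem_nil (mem_edges_of_mem_cutSide hT h hK hK' .nil)

lemma right_notMem_cutSide (hT : T.IsAcyclic) (h : T.Adj K₁ K₂) (h₂ : K₂ ∈ S) :
    K₂ ∉ cutSide T S K₁ K₂ :=
  Finset.disjoint_right.1 (disjoint_cutSide hT h) (left_mem_cutSide h₂)

lemma cutSide_ssubset (hT : T.IsAcyclic) (h : T.Adj K₁ K₂) (h₂ : K₂ ∈ S) :
    cutSide T S K₁ K₂ ⊂ S :=
  Finset.ssubset_iff_subset_ne.2 ⟨cutSide_subset T S K₁ K₂,
    fun he => right_notMem_cutSide hT h h₂ (he.symm ▸ h₂)⟩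

lemma exists_isPath_through_edges (hT : T.IsAcyclic) (hS : (T.induce (S : Set N)).Preconnected)
    (h₂ : K₂ ∈ S) (h : T.Adj K₁ K₂) {A B : N} (hA : A ∈ cutSide T S K₁ K₂)
    (hB : B ∈ cutSide T S K₁ K₂) (hAB : T.Adj A B) :
    ∃ (C : N) (p : T.Walk C K₂), p.IsPath ∧ (∀ D ∈ p.support, D ∈ S) ∧
      s(K₁, K₂) ∈ p.edges ∧ s(A, B) ∈ p.edges := by
  obtain ⟨p, hp, hpS⟩ :=
    exists_isPath_of_preconnected_induce hS (cutSide_subset T S K₁ K₂ hA) h₂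
  obtain ⟨q, hq, hqS⟩ :=
    exists_isPath_of_preconnected_induce hS (cutSide_subset T S K₁ K₂ hB) h₂
  have hmem := mem_edges_of_isAcyclic hT hAB (p.append q.reverse)
  rw [Walk.edges_append, List.mem_append, Walk.edges_reverse, List.mem_reverse] at hmem
  rcases hmem with hABp | hABq
  · exact ⟨A, p, hp, hpS, mem_edges_of_mem_cutSide hT h hA (left_mem_cutSide h₂) p, hABp⟩
  · exact ⟨B, q, hq, hqS, mem_edges_of_mem_cutSide hT h hB (left_mem_cutSide h₂) q, hABq⟩

end Cut

/-! ### Edge-rankings -/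

section EdgeRanking

variable {N : Type*} {T : SimpleGraph N} {φ : Sym2 N → ℕ} {S : Finset N} {K₁ K₂ : N}

/-- `K₁K₂` is an edge of `T` inside `S` along which `FindBiclique` may cut the subtree with node set
`S`: it has the largest rank of all edges inside `S`. -/
structure IsMaxRankEdge (T : SimpleGraph N) (φ : Sym2 N → ℕ) (S : Finset N) (K₁ K₂ : N) :
    Prop where
  left_mem : K₁ ∈ S
  right_mem : K₂ ∈ S
  adj : T.Adj K₁ K₂
  rank_le : ∀ A ∈ S, ∀ B ∈ S, T.Adj A B → φ s(A, B) ≤ φ s(K₁, K₂)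

lemma IsMaxRankEdge.symm (h : IsMaxRankEdge T φ S K₁ K₂) : IsMaxRankEdge T φ S K₂ K₁ :=
  ⟨h.right_mem, h.left_mem, h.adj.symm, Sym2.eq_swap (a := K₁) ▸ h.rank_le⟩

lemma exists_isMaxRankEdge (φ : Sym2 N → ℕ) (hS : (T.induce (S : Set N)).Preconnected)
    (hcard : 1 < S.card) : ∃ K₁ K₂, IsMaxRankEdge T φ S K₁ K₂ := by
  classical
  have edges_nonempty : ((S ×ˢ S).filter fun q => T.Adj q.1 q.2).Nonempty := by
    obtain ⟨A, hA, B, hB, hne⟩ := Finset.one_lt_card.1 hcard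
    obtain ⟨p, hp⟩ := preconnected_induce_iff_exists_walk.1 hS A hA B hB
    have hnil : ¬p.Nil := Walk.not_nil_of_ne hne
    exact ⟨(A, p.snd), by simpa using ⟨⟨hA, hp _ (p.getVert_mem_support 1)⟩, p.adj_snd hnil⟩⟩
  obtain ⟨⟨K₁, K₂⟩, hK, hmax⟩ := Finset.exists_max_image _ (fun q => φ s(q.1, q.2)) edges_nonempty
  simp only [Finset.mem_filter, Finset.mem_product] at hK hmax
  exact ⟨K₁, K₂, hK.1.1, hK.1.2, hK.2, fun A hA B hB h => hmax (A, B) ⟨⟨hA, hB⟩, h⟩⟩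

lemma IsMaxRankEdge.rank_lt_of_mem_cutSide (h : IsMaxRankEdge T φ S K₁ K₂) (hT : T.IsAcyclic)
    {r : ℕ} (hφ : IsEdgeRanking T r φ) (hS : (T.induce (S : Set N)).Preconnected) {A B : N}
    (hA : A ∈ cutSide T S K₁ K₂) (hB : B ∈ cutSide T S K₁ K₂) (hAB : T.Adj A B) :
    φ s(A, B) < φ s(K₁, K₂) := by
  have hsub := cutSide_subset T S K₁ K₂
  refine (h.rank_le A (hsub hA) B (hsub hB) hAB).lt_of_ne fun heq => ?_
  have hK₂ := right_notMem_cutSide hT h.adj h.right_mem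
  have hne : s(A, B) ≠ s(K₁, K₂) := by
    rintro he
    rcases Sym2.eq_iff.1 he with ⟨-, rfl⟩ | ⟨rfl, -⟩
    exacts [hK₂ hB, hK₂ hA]
  obtain ⟨C, p, hp, hpS, hK, hABp⟩ :=
    exists_isPath_through_edges hT hS h.right_mem h.adj hA hB hAB
  obtain ⟨⟨D, E⟩, he, hlt⟩ := hφ.2 _ _ p hp _ hABp _ hK hne heq
  exact hlt.not_ge <| heq ▸ h.rank_le D (hpS D (p.fst_mem_support_of_mem_edges he)) E
    (hpS E (p.snd_mem_support_of_mem_edges he)) (p.adj_of_mem_edges he)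

lemma exists_isOptimalEdgeRanking [Finite N] (T : SimpleGraph N) :
    ∃ φ, IsOptimalEdgeRanking T φ := by
  obtain ⟨n, ⟨f⟩⟩ := Finite.exists_equiv_fin (Sym2 N)
  refine Nat.sInf_mem (s := {r : ℕ | ∃ φ : Sym2 N → ℕ, IsEdgeRanking T r φ})
    ⟨n, fun e => f e + 1, fun e _ => ⟨Nat.le_add_left 1 _, (f e).2⟩, ?_⟩
  intro a b p _ e₁ _ e₂ _ hne heq
  exact absurd (f.injective (Fin.ext (Nat.succ_injective heq))) hne

end EdgeRanking

/-! ### Breadth-first search -/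

section BreadthFirst

variable {N : Type*} {T : SimpleGraph N} {root : N} {l : List N} {i : ℕ}

lemma exists_isLeaf [Finite N] (hT : T.IsTree) : ∃ v, IsLeaf T v := by
  classical
  have := Fintype.ofFinite N
  rcases subsingleton_or_nontrivial N with _ | _
  · obtain ⟨v⟩ := hT.connected.nonempty
    exact ⟨v, Set.subsingleton_of_subsingleton⟩
  · obtain ⟨v, hv⟩ := hT.exists_vert_degree_one_of_nontrivial
    obtain ⟨w, -, huniq⟩ := degree_eq_one_iff_existsUnique_adj.1 hv
    exact ⟨v, fun a ha b hb => (huniq a ha).trans (huniq b hb).symm⟩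

lemma BFSState.nodup (h : BFSState T root l i) : l.Nodup := by
  induction h with
  | start => exact List.nodup_singleton _
  | step _ _ _ _ hnodup hnew _ ih =>
    exact List.nodup_append.2 ⟨ih, hnodup, fun a ha b hb hab => ((hnew b).1 hb).2 (hab ▸ ha)⟩

lemma BFSState.le_length (h : BFSState T root l i) : i ≤ l.length := by
  induction h with
  | start => exact Nat.zero_le _
  | step _ _ _ hi => rw [List.length_append]; omega

lemma BFSState.exists_complete [Finite N] (h : BFSState T root l i) :
    ∃ l', BFSState T root l' l'.length := by
  classical
  have := Fintype.ofFinite N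
  induction hk : Fintype.card N - i generalizing l i with
  | zero =>
    have h₁ := h.nodup.length_le_card
    have h₂ := h.le_length
    obtain rfl : i = l.length := by omega
    exact ⟨l, h⟩
  | succ k ih =>
    rcases h.le_length.eq_or_lt with rfl | hi
    · exact ⟨l, h⟩
    · exact ih (BFSState.step l (Finset.univ.filter fun K => T.Adj l[i] K ∧ K ∉ l).toList i hi
        (Finset.nodup_toList _) (by simp) h) (by omega)

lemma exists_isBFSOrdering [Finite N] (T : SimpleGraph N) (root : N) :
    ∃ σ, IsBFSOrdering T root σ := by
  classical
  obtain ⟨l, hl⟩ := (BFSState.start (T := T) (root := root)).exists_complete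
  exact ⟨fun K => l.idxOf K + 1, l, hl, fun i hi => by simp only [hl.nodup.idxOf_getElem]⟩

lemma BFSState.root_mem (h : BFSState T root l i) : root ∈ l := by
  induction h with
  | start => exact List.mem_singleton_self _
  | step _ _ _ _ _ _ _ ih => exact List.mem_append_left _ ih

lemma BFSState.mem_of_adj_getElem (h : BFSState T root l i) {j : ℕ} (hj : j < l.length)
    (hji : j < i) {K : N} (hK : T.Adj l[j] K) : K ∈ l := by
  induction h with
  | start => omega
  | step l new i hi _ hnew _ ih =>
    have hjl : j < l.length := by omega
    rw [List.getElem_append_left hjl] at hK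
    by_cases hKl : K ∈ l
    · exact List.mem_append_left _ hKl
    · rcases Nat.lt_succ_iff_lt_or_eq.1 hji with h | rfl
      · exact absurd (ih hjl h hK) hKl
      · exact List.mem_append_right _ ((hnew K).2 ⟨hK, hKl⟩)

lemma BFSState.exists_adj_getElem_lt (h : BFSState T root l i) {j : ℕ} (hj : j < l.length)
    (hne : l[j] ≠ root) : ∃ (k : ℕ) (hk : k < j), T.Adj l[k] l[j] := by
  induction h with
  | start => exact absurd (List.getElem_singleton hj) hne
  | step l new i hi _ hnew _ ih =>
    by_cases hjl : j < l.length
    · rw [List.getElem_append_left hjl] at hne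
      obtain ⟨k, hk, h⟩ := ih hjl hne
      refine ⟨k, hk, ?_⟩
      rwa [List.getElem_append_left hjl, List.getElem_append_left]
    · refine ⟨i, by omega, ?_⟩
      rw [List.getElem_append_left hi, List.getElem_append_right (by omega)]
      exact ((hnew _).1 (List.getElem_mem _)).1

lemma BFSState.mem_of_connected (hT : T.Connected) (h : BFSState T root l l.length) (K : N) :
    K ∈ l := by
  obtain ⟨p⟩ := hT.preconnected root K
  suffices ∀ (A B : N) (_ : T.Walk A B), A ∈ l → B ∈ l from this _ _ p h.root_mem
  intro A B p
  induction p with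
  | nil => exact id
  | cons hadj _ ih =>
    intro hA
    obtain ⟨j, hj, rfl⟩ := List.getElem_of_mem hA
    exact ih (h.mem_of_adj_getElem hj hj hadj)

end BreadthFirst

/-! ### Search orders -/

section SearchOrder

variable {N : Type*} {T : SimpleGraph N} {root : N} {σ : N → ℕ}

/-- `P` is a parent of `K` in the graph `T` whose nodes are numbered by `σ`: a neighbour of `K` with
a smaller number. -/
def IsParent (T : SimpleGraph N) (σ : N → ℕ) (P K : N) : Prop :=
  T.Adj P K ∧ σ P < σ K

/-- `σ` numbers the nodes of `T` in the order in which some graph search from `root` (breadth-first,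
depth-first or any other) discovers them. -/
structure IsSearchOrder (T : SimpleGraph N) (root : N) (σ : N → ℕ) : Prop where
  injective : Function.Injective σ
  exists_parent : ∀ K, K ≠ root → ∃ P, IsParent T σ P K

lemma IsBFSOrdering.isSearchOrder (hT : T.Connected) (hσ : IsBFSOrdering T root σ) :
    IsSearchOrder T root σ := by
  obtain ⟨l, hl, hlσ⟩ := hσ
  refine ⟨fun A B hAB => ?_, fun K hK => ?_⟩
  · obtain ⟨i, hi, rfl⟩ := List.getElem_of_mem (hl.mem_of_connected hT A)
    obtain ⟨j, hj, rfl⟩ := List.getElem_of_mem (hl.mem_of_connected hT B)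
    rw [hlσ, hlσ] at hAB
    obtain rfl : i = j := by omega
    rfl
  · obtain ⟨j, hj, rfl⟩ := List.getElem_of_mem (hl.mem_of_connected hT K)
    obtain ⟨k, hk, h⟩ := hl.exists_adj_getElem_lt hj hK
    exact ⟨_, h, by rw [hlσ, hlσ]; omega⟩

lemma IsSearchOrder.isParent_or_isParent (hσ : IsSearchOrder T root σ) {A B : N}
    (h : T.Adj A B) : IsParent T σ A B ∨ IsParent T σ B A :=
  (hσ.injective.ne h.ne).lt_or_gt.imp (⟨h, ·⟩) (⟨h.symm, ·⟩)

lemma IsSearchOrder.exists_walk_root (hσ : IsSearchOrder T root σ) (K : N) :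
    ∃ p : T.Walk K root, ∀ A ∈ p.support, σ A ≤ σ K := by
  induction hn : σ K using Nat.strong_induction_on generalizing K with
  | _ n ih =>
    subst hn
    by_cases hK : K = root
    · subst hK
      exact ⟨.nil, by simp⟩
    · obtain ⟨P, hP, hlt⟩ := hσ.exists_parent K hK
      obtain ⟨p, hp⟩ := ih _ hlt P rfl
      refine ⟨.cons hP.symm p, fun A hA => ?_⟩
      rcases List.mem_cons.1 (Walk.support_cons _ p ▸ hA) with rfl | hA
      · exact le_rfl
      · exact (hp A hA).trans hlt.le

lemma IsSearchOrder.exists_walk_of_lt (hσ : IsSearchOrder T root σ) {A B : N} {n : ℕ}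
    (hA : σ A < n) (hB : σ B < n) : ∃ p : T.Walk A B, ∀ C ∈ p.support, σ C < n := by
  obtain ⟨p, hp⟩ := hσ.exists_walk_root A
  obtain ⟨q, hq⟩ := hσ.exists_walk_root B
  refine ⟨p.append q.reverse, fun C hC => ?_⟩
  rw [Walk.mem_support_append_iff, Walk.support_reverse, List.mem_reverse] at hC
  exact hC.elim (fun h => (hp C h).trans_lt hA) (fun h => (hq C h).trans_lt hB)

lemma IsSearchOrder.parent_unique (hσ : IsSearchOrder T root σ) (hT : T.IsAcyclic) {K P Q : N}
    (hP : IsParent T σ P K) (hQ : IsParent T σ Q K) : P = Q := by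
  obtain ⟨q, hq⟩ := hσ.exists_walk_of_lt hQ.2 hP.2
  have hmem := mem_edges_of_isAcyclic hT hP.1.symm (.cons hQ.1.symm q)
  rw [Walk.edges_cons, List.mem_cons, Sym2.congr_right] at hmem
  exact hmem.resolve_right fun h => (hq K (q.fst_mem_support_of_mem_edges h)).false

/-- `S` is the node set of a subtree of `T` whose first node in the order `σ` is `t`. -/
structure IsRootedSubtree (T : SimpleGraph N) (σ : N → ℕ) (S : Finset N) (t : N) : Prop where
  preconnected : (T.induce (S : Set N)).Preconnected
  root_mem : t ∈ S
  root_le : ∀ C ∈ S, σ t ≤ σ C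

lemma exists_isRootedSubtree {S : Finset N} (hS : (T.induce (S : Set N)).Preconnected)
    (hne : S.Nonempty) : ∃ t, IsRootedSubtree T σ S t ∧ σ t = S.inf' hne σ := by
  obtain ⟨t, ht, hmin⟩ := S.exists_mem_eq_inf' hne σ
  exact ⟨t, ⟨hS, ht, fun C hC => hmin ▸ S.inf'_le σ hC⟩, hmin.symm⟩

variable {S S' : Finset N} {t t' : N}

lemma IsRootedSubtree.eq_root_of_isParent (hS : IsRootedSubtree T σ S t) (hT : T.IsAcyclic)
    (hσ : IsSearchOrder T root σ) {A P : N} (hA : A ∈ S) (hP : P ∉ S) (hPA : IsParent T σ P A) :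
    A = t := by
  by_contra hne
  have htA : σ t < σ A := (hS.root_le A hA).lt_of_ne (hσ.injective.ne (Ne.symm hne))
  obtain ⟨p, hp⟩ := preconnected_induce_iff_exists_walk.1 hS.preconnected A hA t hS.root_mem
  obtain ⟨q, hq⟩ := hσ.exists_walk_of_lt htA hPA.2
  have hmem := mem_edges_of_isAcyclic hT hPA.1.symm (p.append q)
  rw [Walk.edges_append, List.mem_append] at hmem
  rcases hmem with h | h
  · exact hP (hp P (p.snd_mem_support_of_mem_edges h))
  · exact (hq A (q.fst_mem_support_of_mem_edges h)).false

lemma IsRootedSubtree.root_lt_of_isParent (hS : IsRootedSubtree T σ S t) (hT : T.IsAcyclic)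
    (hσ : IsSearchOrder T root σ) {A P : N} (hA : A ∈ S) (hP : P ∉ S) (hPA : IsParent T σ P A) :
    σ P < σ t :=
  hS.eq_root_of_isParent hT hσ hA hP hPA ▸ hPA.2

lemma IsRootedSubtree.eq_root_or_eq_root_of_disjoint (hS : IsRootedSubtree T σ S t)
    (hS' : IsRootedSubtree T σ S' t') (hT : T.IsAcyclic) (hσ : IsSearchOrder T root σ)
    (hdisj : Disjoint S S') (hlt : σ t' < σ t) {A B C : N} (hA : A ∈ S) (hB : B ∈ S')
    (hAC : A = C ∨ T.Adj A C) (hBC : B = C ∨ T.Adj B C) :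
    (C = t ∧ IsParent T σ B t) ∨ (A = t ∧ IsParent T σ C t) := by
  have notMem_S' {D} (hD : D ∈ S) : D ∉ S' := Finset.disjoint_left.1 hdisj hD
  have hBS : B ∉ S := fun h => notMem_S' h hB
  have not_isParent {D E} (hD : D ∉ S') (hE : E ∈ S') (hle : σ t ≤ σ D) : ¬IsParent T σ D E :=
    fun h => (hS'.root_lt_of_isParent hT hσ hE hD h).not_ge (hlt.le.trans hle)
  by_cases hC : C ∈ S
  · have hadj : T.Adj B C := hBC.resolve_left fun h => hBS (h ▸ hC)
    have hparent : IsParent T σ B C := (hσ.isParent_or_isParent hadj).resolve_right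
      (not_isParent (notMem_S' hC) hB (hS.root_le C hC))
    obtain rfl := hS.eq_root_of_isParent hT hσ hC hBS hparent
    exact Or.inl ⟨rfl, hparent⟩
  have hadj : T.Adj A C := hAC.resolve_left fun h => hC (h ▸ hA)
  rcases hσ.isParent_or_isParent hadj with hAC | hCA
  · exfalso
    have hCS' : C ∉ S' := fun h => not_isParent (notMem_S' hA) h (hS.root_le A hA) hAC
    rcases hσ.isParent_or_isParent (hBC.resolve_left fun h => hCS' (h ▸ hB)) with hBC | hCB
    · exact hBS (hσ.parent_unique hT hBC hAC ▸ hA)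
    · exact not_isParent hCS' hB ((hS.root_le A hA).trans hAC.2.le) hCB
  · obtain rfl := hS.eq_root_of_isParent hT hσ hA hC hCA
    exact Or.inr ⟨rfl, hCA⟩

end SearchOrder

/-! ### Clique trees -/

section CliqueTree

variable {V : Type*} {G : SimpleGraph V}

lemma MaxClique.not_adj (K : MaxClique Gᶜ) {u v : V} (hu : u ∈ K.verts) (hv : v ∈ K.verts) :
    ¬G.Adj u v :=
  fun h => (K.2.prop hu hv h.ne).2 h

lemma MaxClique.exists_of_not_adj [Finite V] {u v : V} (h : ¬G.Adj u v) :
    ∃ K : MaxClique Gᶜ, u ∈ K.verts ∧ v ∈ K.verts := by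
  classical
  have hc : Gᶜ.IsClique (({u, v} : Finset V) : Set V) := by
    rw [Finset.coe_pair, isClique_pair]
    exact fun hne => ⟨hne, h⟩
  obtain ⟨K, hle, hK⟩ := Finite.exists_le_maximal
    (p := fun s : Finset V => Gᶜ.IsClique (s : Set V)) hc
  exact ⟨⟨K, hK⟩, hle (by simp), hle (by simp)⟩

lemma MaxClique.exists_mem_notMem {H : SimpleGraph V} {K₁ K₂ : MaxClique H} (hne : K₁ ≠ K₂) :
    ∃ v ∈ K₁.verts, v ∉ K₂.verts := by
  by_contra! h
  exact hne (Subtype.ext (K₁.2.eq_of_le K₂.2.prop h))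

lemma InAtMostTwoMaxIndepSets.eq_or_eq [Fintype V] (h2 : InAtMostTwoMaxIndepSets G) {v : V}
    {A B C : MaxClique Gᶜ} (hA : v ∈ A.verts) (hB : v ∈ B.verts) (hC : v ∈ C.verts)
    (hAB : A ≠ B) : C = A ∨ C = B := by
  classical
  by_contra! hne
  have hcard : ({C.1, A.1, B.1} : Set (Finset V)).ncard = 3 :=
    Set.ncard_eq_three.2 ⟨_, _, _, Subtype.val_injective.ne hne.1, Subtype.val_injective.ne hne.2,
      Subtype.val_injective.ne hAB, rfl⟩
  have hsub : {C.1, A.1, B.1} ⊆ {I : Finset V |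
      Maximal (fun s : Finset V => G.IsIndepSet (s : Set V)) I ∧ v ∈ I} := by
    simp only [← isClique_compl]
    rintro I (rfl | rfl | rfl)
    exacts [⟨C.2, hC⟩, ⟨A.2, hA⟩, ⟨B.2, hB⟩]
  have := Set.ncard_le_ncard hsub (Set.toFinite _)
  have := h2 v
  omega

/-- The vertices of the parents of the node `t`. -/
def parentVerts {H : SimpleGraph V} (T : SimpleGraph (MaxClique H)) (σ : MaxClique H → ℕ)
    (t : MaxClique H) : Set V :=
  {x | ∃ P, IsParent T σ P t ∧ x ∈ P.verts}

lemma isIndepSet_parentVerts {T : SimpleGraph (MaxClique Gᶜ)} {root : MaxClique Gᶜ}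
    {σ : MaxClique Gᶜ → ℕ} (hσ : IsSearchOrder T root σ) (hT : T.IsAcyclic)
    (t : MaxClique Gᶜ) :
    G.IsIndepSet (parentVerts T σ t) := by
  rintro x ⟨P, hP, hx⟩ y ⟨Q, hQ, hy⟩ -
  obtain rfl := hσ.parent_unique hT hP hQ
  exact P.not_adj hx hy

variable [DecidableEq V] {T : SimpleGraph (MaxClique Gᶜ)}

lemma IsCliqueTree.adj_of_mem [Fintype V] (hT : IsCliqueTree Gᶜ T)
    (h2 : InAtMostTwoMaxIndepSets G) {A B : MaxClique Gᶜ} {v : V} (hA : v ∈ A.verts)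
    (hB : v ∈ B.verts) (hne : A ≠ B) : T.Adj A B := by
  obtain ⟨p, hp⟩ := hT.isTree.connected.exists_isPath A B
  have hnil : ¬p.Nil := Walk.not_nil_of_ne hne
  have hsnd : v ∈ p.snd.verts :=
    hT.inter_subset A B p hp _ (p.getVert_mem_support 1) (Finset.mem_inter.2 ⟨hA, hB⟩)
  have hadj := p.adj_snd hnil
  exact (h2.eq_or_eq hA hB hsnd hne).resolve_left hadj.ne' ▸ hadj

lemma IsCliqueTree.mem_inter_of_mem_edges {H : SimpleGraph V} {T : SimpleGraph (MaxClique H)}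
    (hT : IsCliqueTree H T) {A B K₁ K₂ : MaxClique H} {p : T.Walk A B} (hp : p.IsPath)
    (he : s(K₁, K₂) ∈ p.edges) {v : V} (hA : v ∈ A.verts) (hB : v ∈ B.verts) :
    v ∈ K₁.verts ∩ K₂.verts :=
  have hsub := hT.inter_subset A B p hp
  have hv := Finset.mem_inter.2 ⟨hA, hB⟩
  Finset.mem_inter.2 ⟨hsub _ (p.fst_mem_support_of_mem_edges he) hv,
    hsub _ (p.snd_mem_support_of_mem_edges he) hv⟩

lemma mem_sideVerts {H : SimpleGraph V} {S : Finset (MaxClique H)} {K₁ K₂ : MaxClique H} {v : V} :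
    v ∈ sideVerts S K₁ K₂ ↔ (∃ A ∈ S, v ∈ A.verts) ∧ v ∉ K₁.verts ∩ K₂.verts := by
  rw [sideVerts, Finset.mem_sdiff, Finset.mem_biUnion]

/-- The biclique that `FindBiclique` reads off when it cuts the subtree with node set `S` along the
edge `K₁K₂`. -/
noncomputable def cutBiclique {H : SimpleGraph V} (T : SimpleGraph (MaxClique H))
    (S : Finset (MaxClique H)) (K₁ K₂ : MaxClique H) : Biclique V :=
  (sideVerts (cutSide T S K₁ K₂) K₁ K₂, sideVerts (cutSide T S K₂ K₁) K₁ K₂)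

lemma IsCliqueTree.isBiclique_cutBiclique [Finite V] (hT : IsCliqueTree Gᶜ T)
    {S : Finset (MaxClique Gᶜ)} {K₁ K₂ : MaxClique Gᶜ} (h₁ : K₁ ∈ S) (h₂ : K₂ ∈ S)
    (h : T.Adj K₁ K₂) : IsBiclique G (cutBiclique T S K₁ K₂) := by
  refine ⟨?_, ?_, fun u hu v hv => ?_⟩
  · obtain ⟨v, hv, hv'⟩ := MaxClique.exists_mem_notMem h.ne
    exact ⟨v, mem_sideVerts.2 ⟨⟨K₁, left_mem_cutSide h₁, hv⟩,
      fun h => hv' (Finset.mem_inter.1 h).2⟩⟩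
  · obtain ⟨v, hv, hv'⟩ := MaxClique.exists_mem_notMem h.ne'
    exact ⟨v, mem_sideVerts.2 ⟨⟨K₂, left_mem_cutSide h₂, hv⟩,
      fun h => hv' (Finset.mem_inter.1 h).1⟩⟩
  · obtain ⟨⟨A, hA, huA⟩, hu⟩ := mem_sideVerts.1 hu
    obtain ⟨⟨B, hB, hvB⟩, hv⟩ := mem_sideVerts.1 hv
    by_contra hadj
    obtain ⟨C, huC, hvC⟩ := MaxClique.exists_of_not_adj hadj
    obtain ⟨p, hp⟩ := hT.isTree.connected.exists_isPath A C
    obtain ⟨q, hq⟩ := hT.isTree.connected.exists_isPath C B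
    have hmem := mem_edges_of_mem_cutSide hT.isTree.isAcyclic h hA hB (p.append q)
    rw [Walk.edges_append, List.mem_append] at hmem
    rcases hmem with he | he
    · exact hu (hT.mem_inter_of_mem_edges hp he huA huC)
    · exact hv (hT.mem_inter_of_mem_edges hq he hvC hvB)

lemma IsCliqueTree.mem_root_and_mem_parentVerts [Fintype V] (hT : IsCliqueTree Gᶜ T)
    (h2 : InAtMostTwoMaxIndepSets G) {root : MaxClique Gᶜ} {σ : MaxClique Gᶜ → ℕ}
    (hσ : IsSearchOrder T root σ) {S S' : Finset (MaxClique Gᶜ)} {t t' : MaxClique Gᶜ}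
    (hS : IsRootedSubtree T σ S t) (hS' : IsRootedSubtree T σ S' t') (hdisj : Disjoint S S')
    (hlt : σ t' < σ t) {z x : V} (hz : z ∈ S.biUnion MaxClique.verts)
    (hx : x ∈ S'.biUnion MaxClique.verts) (hzx : ¬G.Adj z x) :
    z ∈ t.verts ∧ x ∈ parentVerts T σ t := by
  obtain ⟨A, hA, hzA⟩ := Finset.mem_biUnion.1 hz
  obtain ⟨B, hB, hxB⟩ := Finset.mem_biUnion.1 hx
  obtain ⟨C, hzC, hxC⟩ := MaxClique.exists_of_not_adj hzx
  have hAC : A = C ∨ T.Adj A C := or_iff_not_imp_left.2 (hT.adj_of_mem h2 hzA hzC)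
  have hBC : B = C ∨ T.Adj B C := or_iff_not_imp_left.2 (hT.adj_of_mem h2 hxB hxC)
  rcases hS.eq_root_or_eq_root_of_disjoint hS' hT.isTree.isAcyclic hσ hdisj hlt hA hB hAC hBC with
    ⟨rfl, hP⟩ | ⟨rfl, hP⟩
  exacts [⟨hzC, B, hP, hxB⟩, ⟨hzA, C, hP, hxC⟩]

end CliqueTree

/-! ### Merging -/

section Merge

lemma exists_rel_of_prefix_map {α β : Type*} {R : α → α → Prop} {f : α → β} {s : List α}
    (hs : s.Pairwise R) {l : List β} {b : β} (h : l ++ [b] <+: s.map f) :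
    ∃ y ∈ s, f y = b ∧ ∀ c ∈ l, ∃ y' ∈ s, R y' y ∧ f y' = c := by
  obtain ⟨w, hw, hmap⟩ := List.prefix_map_iff.1 h
  obtain ⟨w, w', rfl, rfl, hw'⟩ := List.map_eq_append_iff.1 hmap.symm
  obtain ⟨y, rfl, rfl⟩ := List.map_eq_singleton_iff.1 hw'
  have hR := (List.pairwise_append.1 (hs.sublist hw.sublist)).2.2
  refine ⟨y, hw.subset (by simp), rfl, fun c hc => ?_⟩
  obtain ⟨y', hy', rfl⟩ := List.mem_map.1 hc
  exact ⟨y', hw.subset (List.mem_append_left _ hy'), hR y' hy' y (by simp), rfl⟩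

lemma pairwise_lt_mergeSort {α β : Type*} [LinearOrder β] {key : α → β} {l : List α}
    (hl : l.Pairwise fun x y => key x ≠ key y) :
    (l.mergeSort fun x y => decide (key x ≤ key y)).Pairwise fun x y => key x < key y := by
  have hle := l.pairwise_mergeSort (le := fun x y => decide (key x ≤ key y))
    (fun x y z hxy hyz => decide_eq_true ((of_decide_eq_true hxy).trans (of_decide_eq_true hyz)))
    (fun x y => by simpa using le_total (key x) (key y))
  have hne := ((l.mergeSort_perm fun x y => decide (key x ≤ key y)).pairwise_iff Ne.symm).2 hl
  exact hle.imp₂ (fun _ _ h => lt_of_le_of_ne (of_decide_eq_true h)) hne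

variable {V : Type*} {G : SimpleGraph V}

/-- `b` covers the edge `uv`, in one of the two orientations. -/
def Covers (b : Biclique V) (u v : V) : Prop :=
  (u ∈ b.1 ∧ v ∈ b.2) ∨ (v ∈ b.1 ∧ u ∈ b.2)

lemma Covers.mono {b c : Biclique V} {u v : V} (h : Covers b u v) (hle : b ≤ c) : Covers c u v :=
  h.imp (And.imp (@hle.1 _) (@hle.2 _)) (And.imp (@hle.1 _) (@hle.2 _))

lemma Covers.swap {b : Biclique V} {u v : V} (h : Covers b u v) : Covers b.swap u v :=
  h.symm.imp And.symm And.symm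

/-- In the rectangle `X × Y`, the pairs that are not adjacent in `G` all come from the product of an
independent set `Z` and an independent set `P`. -/
def ConflictsConfined (G : SimpleGraph V) (X Y : Set V) : Prop :=
  ∃ Z P : Set V, G.IsIndepSet Z ∧ G.IsIndepSet P ∧
    ∀ z ∈ X, ∀ x ∈ Y, ¬G.Adj z x → z ∈ Z ∧ x ∈ P

lemma ConflictsConfined.mono_right {X Y Y' : Set V} (h : ConflictsConfined G X Y)
    (hY : Y' ⊆ Y) : ConflictsConfined G X Y' :=
  let ⟨Z, P, hZ, hP, hconf⟩ := h
  ⟨Z, P, hZ, hP, fun z hz x hx => hconf z hz x (hY hx)⟩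

lemma IsBiclique.notMem_or_notMem_of_isIndepSet {b : Biclique V} (hb : IsBiclique G b) {Z : Set V}
    (hZ : G.IsIndepSet Z) : (∀ z ∈ b.1, z ∉ Z) ∨ ∀ z ∈ b.2, z ∉ Z := by
  by_contra! h
  obtain ⟨⟨z, hz, hzZ⟩, z', hz', hzZ'⟩ := h
  have hadj := hb.2.2 z hz z' hz'
  exact hZ hzZ hzZ' hadj.ne hadj

lemma IsBiclique.swap {b : Biclique V} (hb : IsBiclique G b) : IsBiclique G b.swap :=
  ⟨hb.2.1, hb.1, fun u hu v hv => (hb.2.2 v hv u hu).symm⟩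

variable [DecidableEq V]

/-- The vertices on the two sides of `b`. -/
def Biclique.verts (b : Biclique V) : Finset V := b.1 ∪ b.2

lemma Biclique.verts_swap (b : Biclique V) : Biclique.verts b.swap = b.verts :=
  Finset.union_comm _ _

lemma Biclique.verts_sup (b c : Biclique V) : (b ⊔ c).verts = b.verts ∪ c.verts :=
  Finset.union_union_union_comm _ _ _ _

lemma IsBiclique.sup {b c : Biclique V} (hb : IsBiclique G b) (hc : IsBiclique G c)
    (h₁₂ : ∀ z ∈ b.1, ∀ x ∈ c.2, G.Adj z x) (h₂₁ : ∀ z ∈ b.2, ∀ x ∈ c.1, G.Adj z x) :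
    IsBiclique G (b ⊔ c) := by
  refine ⟨hb.1.mono Finset.subset_union_left, hb.2.1.mono Finset.subset_union_left, ?_⟩
  intro u hu v hv
  rcases Finset.mem_union.1 hu with hu | hu <;> rcases Finset.mem_union.1 hv with hv | hv
  exacts [hb.2.2 u hu v hv, h₁₂ u hu v hv, (h₂₁ v hv u hu).symm, hc.2.2 u hu v hv]

lemma mergeable_of_conflictsConfined {b c : Biclique V} (hb : IsBiclique G b)
    (hc : IsBiclique G c) (h : ConflictsConfined G b.verts c.verts) : Mergeable G b c := by
  obtain ⟨Z, P, hZ, hP, hconf⟩ := h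
  have sup_or_swap_sup {d : Biclique V} (hd : IsBiclique G d) (hverts : d.verts = b.verts)
      (hdZ : ∀ z ∈ d.1, z ∉ Z) : IsBiclique G (d ⊔ c) ∨ IsBiclique G (d.swap ⊔ c) := by
    have adj {z x} (hz : z ∈ d.verts) (hx : x ∈ c.verts) (hzx : z ∉ Z ∨ x ∉ P) : G.Adj z x := by
      by_contra hadj
      exact not_and_or.2 hzx (hconf z (hverts ▸ hz) x hx hadj)
    have fst_mem {z} (hz : z ∈ d.1) : z ∈ d.verts := Finset.mem_union_left _ hz
    have snd_mem {z} (hz : z ∈ d.2) : z ∈ d.verts := Finset.mem_union_right _ hz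
    refine (hc.notMem_or_notMem_of_isIndepSet hP).imp (fun hcP => ?_) fun hcP => ?_
    · exact hd.sup hc
        (fun z hz x hx => adj (fst_mem hz) (Finset.mem_union_right _ hx) (.inl (hdZ z hz)))
        (fun z hz x hx => adj (snd_mem hz) (Finset.mem_union_left _ hx) (.inr (hcP x hx)))
    · exact hd.swap.sup hc
        (fun z hz x hx => adj (snd_mem hz) (Finset.mem_union_right _ hx) (.inr (hcP x hx)))
        (fun z hz x hx => adj (fst_mem hz) (Finset.mem_union_left _ hx) (.inl (hdZ z hz)))
  rcases hb.notMem_or_notMem_of_isIndepSet hZ with hbZ | hbZ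
  · exact sup_or_swap_sup hb rfl hbZ
  · exact (sup_or_swap_sup hb.swap b.verts_swap hbZ).symm

lemma isBiclique_mergeInto {b c : Biclique V} (h : Mergeable G b c) :
    IsBiclique G (mergeInto G b c) := by
  unfold mergeInto
  split_ifs with h₁ h₂
  exacts [h₁, h₂, absurd h (not_or.2 ⟨h₁, h₂⟩)]

lemma mergeInto_eq_sup {b c : Biclique V} (h : Mergeable G b c) :
    mergeInto G b c = b ⊔ c ∨ mergeInto G b c = b.swap ⊔ c := by
  unfold mergeInto
  split_ifs with h₁ h₂
  exacts [Or.inl rfl, Or.inr rfl, absurd h (not_or.2 ⟨h₁, h₂⟩)]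

lemma verts_mergeInto {b c : Biclique V} (h : Mergeable G b c) :
    (mergeInto G b c).verts = b.verts ∪ c.verts := by
  rcases mergeInto_eq_sup h with he | he <;> rw [he, Biclique.verts_sup]
  rw [Biclique.verts_swap]

lemma Covers.mergeInto_left {b c : Biclique V} (h : Mergeable G b c) {u v : V}
    (hb : Covers b u v) : Covers (mergeInto G b c) u v := by
  rcases mergeInto_eq_sup h with he | he <;> rw [he]
  exacts [hb.mono le_sup_left, hb.swap.mono le_sup_left]

lemma Covers.mergeInto_right {b c : Biclique V} (h : Mergeable G b c) {u v : V}
    (hc : Covers c u v) : Covers (mergeInto G b c) u v := by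
  rcases mergeInto_eq_sup h with he | he <;> rw [he] <;> exact hc.mono le_sup_right

lemma mergeStep_empty (b : Biclique V) : mergeStep G ∅ b = {b} := by
  simp [mergeStep]

lemma mergeStep_singleton {b c : Biclique V} (h : Mergeable G b c) :
    mergeStep G {c} b = {mergeInto G b c} := by
  simp [mergeStep, h]

/-- The vertices of the bicliques in the list `l`. -/
def listVerts (l : List (Biclique V)) : Set V := {x | ∃ b ∈ l, x ∈ b.verts}

lemma listVerts_append_singleton (l : List (Biclique V)) (b : Biclique V) :
    listVerts (l ++ [b]) = listVerts l ∪ b.verts := by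
  ext x
  simp [listVerts, or_and_right, exists_or]

/-- `C` is the result of a successful merge of the bicliques in `l`: it consists of at most one
biclique, which has no new vertices and covers every edge that is covered by a member of `l`. -/
structure IsMergeOf (G : SimpleGraph V) (l : List (Biclique V)) (C : Finset (Biclique V)) :
    Prop where
  card_le_one : C.card ≤ 1
  isBiclique : ∀ c ∈ C, IsBiclique G c
  verts_subset : ∀ c ∈ C, (c.verts : Set V) ⊆ listVerts l
  exists_covers : ∀ b ∈ l, ∀ u v, Covers b u v → ∃ c ∈ C, Covers c u v

lemma isMergeOf_singleton {l : List (Biclique V)} {c : Biclique V} :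
    IsMergeOf G l {c} ↔ IsBiclique G c ∧ (c.verts : Set V) ⊆ listVerts l ∧
      ∀ b ∈ l, ∀ u v, Covers b u v → Covers c u v :=
  ⟨fun h => ⟨h.isBiclique c (by simp), h.verts_subset c (by simp), by simpa using h.exists_covers⟩,
    fun h => ⟨by simp, by simpa using h.1, by simpa using h.2.1, by simpa using h.2.2⟩⟩

lemma IsMergeOf.mergeStep {l : List (Biclique V)} {C : Finset (Biclique V)} {b : Biclique V}
    (hC : IsMergeOf G l C) (hb : IsBiclique G b)
    (hconf : ConflictsConfined G b.verts (listVerts l)) :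
    IsMergeOf G (l ++ [b]) (mergeStep G C b) := by
  rcases Finset.card_le_one_iff_subset_singleton.1 hC.card_le_one with ⟨c, hc⟩
  rcases Finset.subset_singleton_iff.1 hc with rfl | rfl
  · rw [mergeStep_empty, isMergeOf_singleton, listVerts_append_singleton]
    refine ⟨hb, Set.subset_union_right, fun b' hb' u v huv => ?_⟩
    rcases List.mem_append.1 hb' with hb' | hb'
    · obtain ⟨c, hc, -⟩ := hC.exists_covers b' hb' u v huv
      exact absurd hc (Finset.notMem_empty c)
    · exact List.mem_singleton.1 hb' ▸ huv
  · obtain ⟨hbic, hverts, hcov⟩ := isMergeOf_singleton.1 hC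
    have hm : Mergeable G b c := mergeable_of_conflictsConfined hb hbic (hconf.mono_right hverts)
    rw [mergeStep_singleton hm, isMergeOf_singleton, listVerts_append_singleton,
      verts_mergeInto hm, Finset.coe_union, Set.union_comm]
    refine ⟨isBiclique_mergeInto hm, Set.union_subset_union_left _ hverts, ?_⟩
    intro b' hb' u v huv
    rcases List.mem_append.1 hb' with hb' | hb'
    · exact (hcov b' hb' u v huv).mergeInto_right hm
    · exact (List.mem_singleton.1 hb' ▸ huv : Covers b u v).mergeInto_left hm

lemma isMergeOf_foldl_mergeStep {l : List (Biclique V)} (hl : ∀ b ∈ l, IsBiclique G b)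
    (hconf : ∀ l' b, l' ++ [b] <+: l → ConflictsConfined G b.verts (listVerts l')) :
    IsMergeOf G l (l.foldl (mergeStep G) ∅) := by
  induction l using List.reverseRecOn with
  | nil => exact ⟨by simp, by simp, by simp, by simp⟩
  | append_singleton l b ih =>
    rw [List.foldl_append, List.foldl_cons, List.foldl_nil]
    refine IsMergeOf.mergeStep (ih (fun b hb => hl b (List.mem_append_left _ hb)) ?_)
      (hl b (by simp)) (hconf l b List.prefix_rfl)
    exact fun l' b' h => hconf l' b' (h.trans (List.prefix_append l [b]))

lemma IsMergeOf.of_mem_iff {l l' : List (Biclique V)} {C : Finset (Biclique V)}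
    (hC : IsMergeOf G l C) (h : ∀ b, b ∈ l ↔ b ∈ l') : IsMergeOf G l' C where
  card_le_one := hC.card_le_one
  isBiclique := hC.isBiclique
  verts_subset := by simpa only [listVerts, h] using hC.verts_subset
  exists_covers := by simpa only [h] using hC.exists_covers

lemma isMergeOf_mergeBiclique {l : List (Biclique V × ℕ)} (hl : ∀ y ∈ l, IsBiclique G y.1)
    (hkeys : l.Pairwise fun y y' => y.2 ≠ y'.2)
    (hconf : ∀ y ∈ l, ConflictsConfined G y.1.verts {x | ∃ y' ∈ l, y'.2 < y.2 ∧ x ∈ y'.1.verts}) :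
    IsMergeOf G (l.map Prod.fst) (mergeBiclique G l) := by
  have hperm := l.mergeSort_perm fun x y => decide (x.2 ≤ y.2)
  refine (isMergeOf_foldl_mergeStep ?_ ?_).of_mem_iff fun b => (hperm.map Prod.fst).mem_iff
  · simpa [hperm.mem_iff] using hl
  · intro l' b hpre
    obtain ⟨y, hy, rfl, hlt⟩ := exists_rel_of_prefix_map (pairwise_lt_mergeSort hkeys) hpre
    refine (hconf y (hperm.mem_iff.1 hy)).mono_right ?_
    rintro x ⟨c, hc, hx⟩
    obtain ⟨y', hy', hkey, rfl⟩ := hlt c hc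
    exact ⟨y', hperm.mem_iff.1 hy', hkey, hx⟩

end Merge

/-! ### The recursive subroutine -/

section FindBiclique

variable {V : Type*} [DecidableEq V] {H : SimpleGraph V} {T : SimpleGraph (MaxClique H)}
  {φ : Sym2 (MaxClique H) → ℕ} {σ : MaxClique H → ℕ} {r i : ℕ} {S : Finset (MaxClique H)}
  {K₁ K₂ : MaxClique H} {D D' : LevelDict V}

lemma exists_findBiclique (hT : T.IsAcyclic)
    (hS : (T.induce (S : Set (MaxClique H))).Preconnected) (D : LevelDict V) :
    ∃ D', FindBiclique T φ σ r S D D' := by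
  induction S using Finset.strongInduction generalizing D with
  | H S ih =>
    rcases le_or_gt S.card 1 with hcard | hcard
    · exact ⟨D, .done S D hcard⟩
    · obtain ⟨K₁, K₂, h⟩ := exists_isMaxRankEdge φ hS hcard
      obtain ⟨D₁, hD₁⟩ := ih _ (cutSide_ssubset hT h.adj h.right_mem)
        (preconnected_induce_cutSide T S K₁ K₂) _
      obtain ⟨D₂, hD₂⟩ := ih _ (cutSide_ssubset hT h.adj.symm h.left_mem)
        (preconnected_induce_cutSide T S K₂ K₁) D₁
      exact ⟨D₂, .cut S D _ D₁ D₂ K₁ K₂ _ hcard h.left_mem h.right_mem h.adj h.rank_le rfl rfl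
        hD₁ hD₂⟩

lemma FindBiclique.subset (h : FindBiclique T φ σ r S D D') (i : ℕ) : D i ⊆ D' i := by
  induction h with
  | done => exact List.Subset.refl _
  | cut S D D₀ D₁ D₂ K₁ K₂ level _ _ _ _ _ _ hD₀ _ _ ih₁ ih₂ =>
    refine List.Subset.trans ?_ (List.Subset.trans ih₁ ih₂)
    rcases eq_or_ne i level with rfl | hi
    · rw [hD₀, Function.update_self]
      exact List.subset_append_left _ _
    · rw [hD₀, Function.update_of_ne hi]
      exact List.Subset.refl _

lemma verts_cutBiclique_subset :
    (cutBiclique T S K₁ K₂).verts ⊆ S.biUnion MaxClique.verts :=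
  Finset.union_subset
    (Finset.sdiff_subset.trans (Finset.biUnion_subset_biUnion_of_subset_left _
      (cutSide_subset T S K₁ K₂)))
    (Finset.sdiff_subset.trans (Finset.biUnion_subset_biUnion_of_subset_left _
      (cutSide_subset T S K₂ K₁)))

lemma mem_biUnion_cutSide_or (hS : (T.induce (S : Set (MaxClique H))).Preconnected) (h₁ : K₁ ∈ S)
    {u : V} (hu : u ∈ S.biUnion MaxClique.verts) :
    u ∈ (cutSide T S K₁ K₂).biUnion MaxClique.verts ∨
      u ∈ (cutSide T S K₂ K₁).biUnion MaxClique.verts := by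
  obtain ⟨A, hA, huA⟩ := Finset.mem_biUnion.1 hu
  exact (mem_cutSide_or_mem_cutSide hS h₁ hA).imp (Finset.mem_biUnion.2 ⟨A, ·, huA⟩)
    (Finset.mem_biUnion.2 ⟨A, ·, huA⟩)

lemma covers_cutBiclique_or (hS : (T.induce (S : Set (MaxClique H))).Preconnected) (h₁ : K₁ ∈ S)
    (h₂ : K₂ ∈ S) {u v : V} (hu : u ∈ S.biUnion MaxClique.verts)
    (hv : v ∈ S.biUnion MaxClique.verts) :
    Covers (cutBiclique T S K₁ K₂) u v ∨
      (u ∈ (cutSide T S K₁ K₂).biUnion MaxClique.verts ∧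
        v ∈ (cutSide T S K₁ K₂).biUnion MaxClique.verts) ∨
      (u ∈ (cutSide T S K₂ K₁).biUnion MaxClique.verts ∧
        v ∈ (cutSide T S K₂ K₁).biUnion MaxClique.verts) := by
  have mem_both_of_mem_mid (x) (hx : x ∈ K₁.verts ∩ K₂.verts) :
      x ∈ (cutSide T S K₁ K₂).biUnion MaxClique.verts ∧
        x ∈ (cutSide T S K₂ K₁).biUnion MaxClique.verts :=
    ⟨Finset.mem_biUnion.2 ⟨K₁, left_mem_cutSide h₁, (Finset.mem_inter.1 hx).1⟩,
      Finset.mem_biUnion.2 ⟨K₂, left_mem_cutSide h₂, (Finset.mem_inter.1 hx).2⟩⟩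
  have hu' := mem_biUnion_cutSide_or (K₂ := K₂) hS h₁ hu
  have hv' := mem_biUnion_cutSide_or (K₂ := K₂) hS h₁ hv
  have hu_mid := mem_both_of_mem_mid u
  have hv_mid := mem_both_of_mem_mid v
  simp only [Covers, cutBiclique, sideVerts, Finset.mem_sdiff]
  tauto

lemma FindBiclique.exists_covers {u v : V} (huv : ∀ K : MaxClique H, u ∈ K.verts → v ∉ K.verts)
    (h : FindBiclique T φ σ r S D D') (hS : (T.induce (S : Set (MaxClique H))).Preconnected)
    (hu : u ∈ S.biUnion MaxClique.verts) (hv : v ∈ S.biUnion MaxClique.verts) :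
    ∃ i, ∃ y ∈ D' i, Covers y.1 u v := by
  induction h with
  | done S D hcard =>
    obtain ⟨A, hA, huA⟩ := Finset.mem_biUnion.1 hu
    obtain ⟨B, hB, hvB⟩ := Finset.mem_biUnion.1 hv
    obtain rfl := Finset.card_le_one.1 hcard A hA B hB
    exact absurd hvB (huv A huA)
  | cut S D D₀ D₁ D₂ K₁ K₂ level _ h₁ h₂ _ _ _ hD₀ hrec₁ hrec₂ ih₁ ih₂ =>
    rcases covers_cutBiclique_or hS h₁ h₂ hu hv with hcov | ⟨hu, hv⟩ | ⟨hu, hv⟩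
    · have hnew : (cutBiclique T S K₁ K₂, S.inf' ⟨K₁, h₁⟩ σ) ∈ D₀ level := by
        rw [hD₀, Function.update_self]
        exact List.mem_append_right _ (List.mem_singleton_self _)
      exact ⟨level, _, hrec₂.subset _ (hrec₁.subset _ hnew), hcov⟩
    · obtain ⟨i, y, hy, hcov⟩ := ih₁ (preconnected_induce_cutSide T S K₁ K₂) hu hv
      exact ⟨i, y, hrec₂.subset i hy, hcov⟩
    · exact ih₂ (preconnected_induce_cutSide T S K₂ K₁) hu hv

/-- `y` can be the entry that `FindBiclique` adds to level `i` when it cuts the subtree with node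
set `S`. -/
structure IsCutEntry (T : SimpleGraph (MaxClique H)) (φ : Sym2 (MaxClique H) → ℕ)
    (σ : MaxClique H → ℕ) (r i : ℕ) (S : Finset (MaxClique H)) (y : Biclique V × ℕ) : Prop where
  exists_root : ∃ t, IsRootedSubtree T σ S t ∧ σ t = y.2
  exists_cut : ∃ K₁ ∈ S, ∃ K₂ ∈ S, T.Adj K₁ K₂ ∧ i = r + 1 - φ s(K₁, K₂) ∧
    y.1 = cutBiclique T S K₁ K₂

lemma IsCutEntry.verts_subset {y : Biclique V × ℕ} (h : IsCutEntry T φ σ r i S y) :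
    y.1.verts ⊆ S.biUnion MaxClique.verts :=
  let ⟨_, _, _, _, _, _, hy⟩ := h.exists_cut
  hy ▸ verts_cutBiclique_subset

lemma IsCutEntry.level_mem_Icc {y : Biclique V × ℕ} (h : IsCutEntry T φ σ r i S y)
    (hφ : IsEdgeRanking T r φ) : i ∈ Finset.Icc 1 r := by
  obtain ⟨K₁, -, K₂, -, hadj, hi, -⟩ := h.exists_cut
  have := hφ.1 s(K₁, K₂) hadj
  rw [Finset.mem_Icc]
  omega

lemma IsCutEntry.lt_level {y : Biclique V × ℕ} {S' : Finset (MaxClique H)}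
    (h : IsCutEntry T φ σ r i S' y) (hK : IsMaxRankEdge T φ S K₁ K₂)
    (hS' : S' ⊆ cutSide T S K₁ K₂) (hT : T.IsAcyclic) (hφ : IsEdgeRanking T r φ)
    (hS : (T.induce (S : Set (MaxClique H))).Preconnected) : r + 1 - φ s(K₁, K₂) < i := by
  obtain ⟨A, hA, B, hB, hadj, hi, -⟩ := h.exists_cut
  have hlt := hK.rank_lt_of_mem_cutSide hT hφ hS (hS' hA) (hS' hB) hadj
  have := hφ.1 s(K₁, K₂) hK.adj
  omega

/-- `l` consists of entries that `FindBiclique` adds to level `i` when it cuts pairwise disjoint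
subtrees of the subtree with node set `S`. -/
def IsCutList (T : SimpleGraph (MaxClique H)) (φ : Sym2 (MaxClique H) → ℕ) (σ : MaxClique H → ℕ)
    (r i : ℕ) (S : Finset (MaxClique H)) (l : List (Biclique V × ℕ)) : Prop :=
  ∃ w : List (Finset (MaxClique H) × (Biclique V × ℕ)), w.map Prod.snd = l ∧
    (∀ q ∈ w, q.1 ⊆ S ∧ IsCutEntry T φ σ r i q.1 q.2) ∧
    w.Pairwise fun q q' => Disjoint q.1 q'.1

lemma isCutList_nil : IsCutList T φ σ r i S [] :=
  ⟨[], by simp⟩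

lemma IsCutEntry.isCutList_singleton {y : Biclique V × ℕ} (h : IsCutEntry T φ σ r i S y) :
    IsCutList T φ σ r i S [y] :=
  ⟨[(S, y)], by simpa using h⟩

lemma IsCutList.append {S₁ S₂ : Finset (MaxClique H)} {l₁ l₂ : List (Biclique V × ℕ)}
    (h₁ : IsCutList T φ σ r i S₁ l₁) (h₂ : IsCutList T φ σ r i S₂ l₂) (hdisj : Disjoint S₁ S₂)
    (hS₁ : S₁ ⊆ S) (hS₂ : S₂ ⊆ S) : IsCutList T φ σ r i S (l₁ ++ l₂) := by
  obtain ⟨w₁, rfl, hw₁, hdisj₁⟩ := h₁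
  obtain ⟨w₂, rfl, hw₂, hdisj₂⟩ := h₂
  refine ⟨w₁ ++ w₂, List.map_append, fun q hq => ?_, List.pairwise_append.2 ⟨hdisj₁, hdisj₂,
    fun q hq q' hq' => hdisj.mono (hw₁ q hq).1 (hw₂ q' hq').1⟩⟩
  rcases List.mem_append.1 hq with hq | hq
  exacts [(hw₁ q hq).imp_left (·.trans hS₁), (hw₂ q hq).imp_left (·.trans hS₂)]

lemma IsCutList.eq_nil {l : List (Biclique V × ℕ)} (hl : IsCutList T φ σ r i (cutSide T S K₁ K₂) l)
    (hK : IsMaxRankEdge T φ S K₁ K₂) (hT : T.IsAcyclic) (hφ : IsEdgeRanking T r φ)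
    (hS : (T.induce (S : Set (MaxClique H))).Preconnected) (hi : i = r + 1 - φ s(K₁, K₂)) :
    l = [] := by
  obtain ⟨w, rfl, hw, -⟩ := hl
  rw [List.map_eq_nil_iff, List.eq_nil_iff_forall_not_mem]
  exact fun q hq => ((hw q hq).2.lt_level hK (hw q hq).1 hT hφ hS).ne' hi

lemma IsCutList.exists_isCutEntry {l : List (Biclique V × ℕ)} (hl : IsCutList T φ σ r i S l)
    {y : Biclique V × ℕ} (hy : y ∈ l) : ∃ S', IsCutEntry T φ σ r i S' y := by
  obtain ⟨w, rfl, hw, -⟩ := hl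
  obtain ⟨q, hq, rfl⟩ := List.mem_map.1 hy
  exact ⟨q.1, (hw q hq).2⟩

lemma IsCutList.pairwise_key_ne {root : MaxClique H} {l : List (Biclique V × ℕ)}
    (hl : IsCutList T φ σ r i S l) (hσ : IsSearchOrder T root σ) :
    l.Pairwise fun y y' => y.2 ≠ y'.2 := by
  obtain ⟨w, rfl, hw, hdisj⟩ := hl
  refine List.pairwise_map.2 (hdisj.imp_of_mem fun {q q'} hq hq' hdisj heq => ?_)
  obtain ⟨t, ht, htq⟩ := (hw q hq).2.exists_root
  obtain ⟨t', ht', htq'⟩ := (hw q' hq').2.exists_root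
  obtain rfl : t = t' := hσ.injective (htq.trans (heq.trans htq'.symm))
  exact Finset.disjoint_left.1 hdisj ht.root_mem ht'.root_mem

lemma FindBiclique.exists_isCutList (h : FindBiclique T φ σ r S D D') (hT : T.IsAcyclic)
    (hφ : IsEdgeRanking T r φ) (hS : (T.induce (S : Set (MaxClique H))).Preconnected) (i : ℕ) :
    ∃ l, D' i = D i ++ l ∧ IsCutList T φ σ r i S l := by
  induction h with
  | done S D => exact ⟨[], (List.append_nil _).symm, isCutList_nil⟩
  | cut S D D₀ D₁ D₂ K₁ K₂ level _ h₁ h₂ hadj hmax hlevel hD₀ _ _ ih₁ ih₂ =>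
    have hK : IsMaxRankEdge T φ S K₁ K₂ := ⟨h₁, h₂, hadj, hmax⟩
    obtain ⟨l₁, hl₁, hcut₁⟩ := ih₁ (preconnected_induce_cutSide T S K₁ K₂)
    obtain ⟨l₂, hl₂, hcut₂⟩ := ih₂ (preconnected_induce_cutSide T S K₂ K₁)
    rw [hl₂, hl₁, hD₀]
    rcases eq_or_ne i level with rfl | hi
    · obtain ⟨t, ht, hkey⟩ := exists_isRootedSubtree (σ := σ) hS ⟨K₁, h₁⟩
      obtain rfl := hcut₁.eq_nil hK hT hφ hS hlevel
      obtain rfl := hcut₂.eq_nil hK.symm hT hφ hS (Sym2.eq_swap (a := K₁) ▸ hlevel)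
      rw [Function.update_self, List.append_nil, List.append_nil]
      exact ⟨_, rfl, IsCutEntry.isCutList_singleton
        ⟨⟨t, ht, hkey⟩, K₁, h₁, K₂, h₂, hadj, hlevel, rfl⟩⟩
    · rw [Function.update_of_ne hi, List.append_assoc]
      exact ⟨_, rfl, hcut₁.append hcut₂ (disjoint_cutSide hT hadj) (cutSide_subset T S K₁ K₂)
        (cutSide_subset T S K₂ K₁)⟩

end FindBiclique

/-! ### The algorithm -/

section Algorithm

variable {V : Type*} [DecidableEq V] {G : SimpleGraph V} {T : SimpleGraph (MaxClique Gᶜ)}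
  {φ : Sym2 (MaxClique Gᶜ) → ℕ} {σ : MaxClique Gᶜ → ℕ} {r i : ℕ} {root : MaxClique Gᶜ}

lemma IsCutEntry.isBiclique [Finite V] {S : Finset (MaxClique Gᶜ)} {y : Biclique V × ℕ}
    (h : IsCutEntry T φ σ r i S y) (hT : IsCliqueTree Gᶜ T) : IsBiclique G y.1 :=
  let ⟨_, h₁, _, h₂, hadj, _, hy⟩ := h.exists_cut
  hy ▸ hT.isBiclique_cutBiclique h₁ h₂ hadj

variable [Fintype V]

lemma IsCutList.conflictsConfined {S : Finset (MaxClique Gᶜ)} {l : List (Biclique V × ℕ)}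
    (hl : IsCutList T φ σ r i S l) (hT : IsCliqueTree Gᶜ T) (h2 : InAtMostTwoMaxIndepSets G)
    (hσ : IsSearchOrder T root σ) {y : Biclique V × ℕ} (hy : y ∈ l) :
    ConflictsConfined G y.1.verts {x | ∃ y' ∈ l, y'.2 < y.2 ∧ x ∈ y'.1.verts} := by
  obtain ⟨w, rfl, hw, hdisj⟩ := hl
  obtain ⟨q, hq, rfl⟩ := List.mem_map.1 hy
  obtain ⟨t, ht, htq⟩ := (hw q hq).2.exists_root
  refine ⟨t.verts, parentVerts T σ t, fun u hu v hv _ => t.not_adj hu hv,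
    isIndepSet_parentVerts hσ hT.isTree.isAcyclic t, ?_⟩
  rintro z hz x ⟨y', hy', hlt, hx⟩ hzx
  obtain ⟨q', hq', rfl⟩ := List.mem_map.1 hy'
  obtain ⟨t', ht', htq'⟩ := (hw q' hq').2.exists_root
  have hqq' : Disjoint q.1 q'.1 := by
    have : Std.Symm fun q q' : Finset (MaxClique Gᶜ) × (Biclique V × ℕ) => Disjoint q.1 q'.1 :=
      ⟨fun _ _ h => h.symm⟩
    exact hdisj.forall hq hq' (by rintro rfl; exact hlt.false)
  exact hT.mem_root_and_mem_parentVerts h2 hσ ht ht' hqq' (htq.symm ▸ htq'.symm ▸ hlt)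
    ((hw q hq).2.verts_subset hz) ((hw q' hq').2.verts_subset hx) hzx

lemma IsCutList.isMergeOf {S : Finset (MaxClique Gᶜ)} {l : List (Biclique V × ℕ)}
    (hl : IsCutList T φ σ r i S l) (hT : IsCliqueTree Gᶜ T) (h2 : InAtMostTwoMaxIndepSets G)
    (hσ : IsSearchOrder T root σ) : IsMergeOf G (l.map Prod.fst) (mergeBiclique G l) :=
  isMergeOf_mergeBiclique (fun _ hy => (hl.exists_isCutEntry hy).elim fun _ h => h.isBiclique hT)
    (hl.pairwise_key_ne hσ) fun _ hy => hl.conflictsConfined hT h2 hσ hy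

/-- `AlgorithmReturns` with an arbitrary number `r` of ranks in place of the optimal one. -/
def RankedAlgorithmReturns (G : SimpleGraph V) (T : SimpleGraph (MaxClique Gᶜ)) (r : ℕ)
    (φ : Sym2 (MaxClique Gᶜ) → ℕ) (σ : MaxClique Gᶜ → ℕ) (C : Finset (Biclique V)) : Prop :=
  ∃ D : LevelDict V, FindBiclique T φ σ r Finset.univ (fun _ => []) D ∧
    C = (Finset.Icc 1 r).biUnion fun i => mergeBiclique G (D i)

lemma exists_rankedAlgorithmReturns (hT : T.IsTree) : ∃ C, RankedAlgorithmReturns G T r φ σ C :=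
  let ⟨D, hD⟩ := exists_findBiclique hT.isAcyclic (preconnected_induce_univ hT.connected) _
  ⟨_, D, hD, rfl⟩

lemma FindBiclique.isCutList {D : LevelDict V}
    (hD : FindBiclique T φ σ r Finset.univ (fun _ => []) D) (hT : T.IsTree)
    (hφ : IsEdgeRanking T r φ) (i : ℕ) : IsCutList T φ σ r i Finset.univ (D i) :=
  let ⟨_, hl, hcut⟩ :=
    hD.exists_isCutList hT.isAcyclic hφ (preconnected_induce_univ hT.connected) i
  hl ▸ hcut

lemma FindBiclique.exists_mem_Icc_covers {D : LevelDict V}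
    (hD : FindBiclique T φ σ r Finset.univ (fun _ => []) D) (hT : T.IsTree)
    (hφ : IsEdgeRanking T r φ) {u v : V} (huv : G.Adj u v) :
    ∃ i ∈ Finset.Icc 1 r, ∃ b ∈ (D i).map Prod.fst, Covers b u v := by
  have mem_univ_biUnion (x : V) :
      x ∈ (Finset.univ : Finset (MaxClique Gᶜ)).biUnion MaxClique.verts :=
    let ⟨K, hK, _⟩ := MaxClique.exists_of_not_adj (G.irrefl (v := x))
    Finset.mem_biUnion.2 ⟨K, Finset.mem_univ K, hK⟩
  obtain ⟨i, y, hy, hcov⟩ := hD.exists_covers (fun K hu hv => K.not_adj hu hv huv)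
    (preconnected_induce_univ hT.connected) (mem_univ_biUnion u) (mem_univ_biUnion v)
  obtain ⟨S, hS⟩ := (hD.isCutList hT hφ i).exists_isCutEntry hy
  exact ⟨i, hS.level_mem_Icc hφ, y.1, List.mem_map_of_mem hy, hcov⟩

lemma RankedAlgorithmReturns.isBicliqueCover {C : Finset (Biclique V)}
    (hC : RankedAlgorithmReturns G T r φ σ C) (hT : IsCliqueTree Gᶜ T)
    (h2 : InAtMostTwoMaxIndepSets G) (hφ : IsEdgeRanking T r φ) (hσ : IsSearchOrder T root σ) :
    IsBicliqueCover G C := by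
  obtain ⟨D, hD, rfl⟩ := hC
  have hmerge := fun i => (hD.isCutList hT.isTree hφ i).isMergeOf hT h2 hσ
  refine ⟨fun b hb => ?_, fun u v huv => ?_⟩
  · obtain ⟨i, -, hb⟩ := Finset.mem_biUnion.1 hb
    exact (hmerge i).isBiclique b hb
  · obtain ⟨i, hi, b, hb, hcov⟩ := hD.exists_mem_Icc_covers hT.isTree hφ huv
    obtain ⟨c, hc, hcov⟩ := (hmerge i).exists_covers b hb u v hcov
    exact ⟨c, Finset.mem_biUnion.2 ⟨i, hi, hc⟩, hcov⟩

lemma RankedAlgorithmReturns.card_le {C : Finset (Biclique V)}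
    (hC : RankedAlgorithmReturns G T r φ σ C) (hT : IsCliqueTree Gᶜ T)
    (h2 : InAtMostTwoMaxIndepSets G) (hφ : IsEdgeRanking T r φ) (hσ : IsSearchOrder T root σ) :
    C.card ≤ r := by
  obtain ⟨D, hD, rfl⟩ := hC
  simpa using Finset.card_biUnion_le_card_mul (Finset.Icc 1 r) (fun i => mergeBiclique G (D i)) 1
    fun i _ => ((hD.isCutList hT.isTree hφ i).isMergeOf hT h2 hσ).card_le_one

end Algorithm

end BicliqueBound

theorem mainTheorem3_general {V : Type*} [Fintype V] [DecidableEq V] (G : SimpleGraph V)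
    (h2 : InAtMostTwoMaxIndepSets G) (T : SimpleGraph (MaxClique Gᶜ)) (hT : IsCliqueTree Gᶜ T) :
    (∃ φ, IsOptimalEdgeRanking T φ) ∧
    (∃ root σ, IsLeaf T root ∧ IsBFSOrdering T root σ) ∧
    (∀ r φ root σ, IsEdgeRanking T r φ → IsSearchOrder T root σ →
      (∃ C, RankedAlgorithmReturns G T r φ σ C) ∧
      ∀ C, RankedAlgorithmReturns G T r φ σ C → IsBicliqueCover G C ∧ C.card ≤ r) ∧
    bicliqueCoverNumber G ≤ edgeRankingNumber T := by
  obtain ⟨φ, hφ⟩ := exists_isOptimalEdgeRanking T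
  obtain ⟨root, hroot⟩ := exists_isLeaf hT.isTree
  obtain ⟨σ, hσ⟩ := exists_isBFSOrdering T root
  refine ⟨⟨φ, hφ⟩, ⟨root, σ, hroot, hσ⟩, fun r φ root σ hφ hσ =>
    ⟨exists_rankedAlgorithmReturns hT.isTree, fun C hC =>
      ⟨hC.isBicliqueCover hT h2 hφ hσ, hC.card_le hT h2 hφ hσ⟩⟩, ?_⟩
  have hσ := hσ.isSearchOrder hT.isTree.connected
  obtain ⟨C, hC⟩ := exists_rankedAlgorithmReturns (φ := φ) (σ := σ) hT.isTree
  have hle : bicliqueCoverNumber G ≤ C.card :=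
    Nat.sInf_le ⟨C, hC.isBicliqueCover hT h2 hφ hσ, rfl⟩
  exact hle.trans (hC.card_le hT h2 hφ hσ)

theorem mainTheorem3 {V : Type*} [Fintype V] [DecidableEq V] (G : SimpleGraph V)
    (hG : IsCoChordal G) (h2 : InAtMostTwoMaxIndepSets G)
    (T : SimpleGraph (MaxClique Gᶜ)) (hT : IsCliqueTree Gᶜ T) :
    -- the choices that the algorithm makes are possible
    (∃ φ, IsOptimalEdgeRanking T φ) ∧
    (∃ root σ, IsLeaf T root ∧ IsBFSOrdering T root σ) ∧
    -- however they are made, the algorithm returns a small biclique cover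
    (∀ φ root σ, IsOptimalEdgeRanking T φ → IsLeaf T root → IsBFSOrdering T root σ →
      (∃ C, AlgorithmReturns G T φ σ C) ∧
      ∀ C, AlgorithmReturns G T φ σ C →
        IsBicliqueCover G C ∧ C.card ≤ edgeRankingNumber T) ∧
    bicliqueCoverNumber G ≤ edgeRankingNumber T := by
  obtain ⟨hφ, hσ, halg, hbc⟩ := mainTheorem3_general G h2 T hT
  exact ⟨hφ, hσ, fun φ root σ hφ _ hσ =>
    halg _ φ root σ hφ (hσ.isSearchOrder hT.isTree.connected), hbc⟩
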